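/- **Theorem (Safety of Ocior).** Let $n \ge 3t+1$ and $k=\lceil (n+t+1)/2\rceil$. *Setting.* There are $n$ consensus nodes and any set of RPC nodes, in an asynchronous network. An adaptive adversary schedules everything, may corrupt at most $t$ consensus nodes in total (and any RPC nodes), and may deliver arbitrary messages in the name of anybody. Cryptography is ideal: hashes are collision free, and the threshold signature under the keys of an epoch on a content is unique and can be generated only from partial signatures (votes) on this content, under keys of this epoch, of at least $k$ distinct nodes; corrupted nodes sign anything. *Transactions.* A transaction lists its inputs; each is an output of a *parent* transaction, given by the identity (hash) of the parent and an index. Two different transactions *double spend* if they have a common input. Two transactions *conflict* if some $a$ and $a'$ double spend, where $a$ is the first transaction or one of its ancestors, and $a'$ is the second transaction or one of its ancestors. An initial transaction without inputs is accepted by all nodes from the start. *APS.* A content names a chain (its proposer), an epoch, a number, a height, a transaction, a virtual parent signature and official parent signatures. A *Type I attested proof of seal* (APS) for a transaction $\mathrm{tx}$ consists of a signature and a content with transaction $\mathrm{tx}$; it is *valid* if the signature verifies for that content under the public key of its epoch. A *Type II APS* consists of a Type I APS and a second signature with content, for the next height of the same chain and with the first signature as its virtual parent; it is valid if both signatures verify.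 It is *generated* once its signatures are. *Protocol.* An honest node that obtains a signature with a content accepts the content's transaction if the signature verifies and its epoch is not later than the node's own; it then also records the transaction as the spender of its inputs. An honest consensus node votes for a proposed transaction only if the proposal is of its current epoch, the official parent signatures that the proposal carries and its virtual parent signature verify (the latter being the only signature the node accepts at the preceding height of the chain), the proposer's earlier proposals are complete, and, moreover, the transaction is accepted already, or comes with a valid APS, or else is signed correctly by its sender, has only accepted parents, has consistent addresses and balances, and spends no output for which a different transaction is recorded (it is then recorded as the spender of its inputs). *Claim.* In every execution: 1. Any two transactions accepted by honest nodes, possibly at different times, do not conflict. 2. If valid APSs (of Type I or II) are generated for two transactions, then these transactions do not conflict. 3. An honest node (consensus or RPC) that receives a valid APS for a transaction, of an epoch not later than the node's current one, accepts this transaction, and it remains accepted ever after. -/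

import Mathlib

/-!
A symbolic model of the asynchronous consensus protocol Ocior.

Cryptography is ideal: a hash is a free term over its input, hence collision free, and a threshold
signature is a free term over the key epoch and the signed content, which can be computed only from
partial signatures of sufficiently many distinct nodes. The network and all scheduling belong to an
adaptive adversary, who may deliver any message it can compute to any node, at any time, in the
name of anybody.
-/

namespace Ocior

noncomputable section

open scoped Classical

/-! ### Transactions -/

/-- Identities of transactions: the (ideal, collision-free) hash of a transaction, or a bit string
that is not the hash of anything. Addresses and amounts are natural numbers. -/
inductive TxId where
  | hash (sender : ℕ) (inputs : List (TxId × ℕ)) (outputs : List (ℕ × ℕ)) (fee : ℕ)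
      (signer : Option ℕ) (payload : ℕ) : TxId
  | other (k : ℕ) : TxId

/-- A transaction. An input `(id, ix)` spends the `ix`-th output of the (official) parent
transaction with identity `id`; an output is a pair (recipient address, amount). `signer` is the
address whose key produced the attached client signature, `none` if that string is no signature. -/
structure Tx where
  sender : ℕ
  inputs : List (TxId × ℕ)
  outputs : List (ℕ × ℕ)
  fee : ℕ
  signer : Option ℕ
  payload : ℕ

/-- The identity (hash) of a transaction. -/
def Tx.id (tx : Tx) : TxId :=
  .hash tx.sender tx.inputs tx.outputs tx.fee tx.signer tx.payload

/-- The total output amount. -/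
def Tx.outAmount (tx : Tx) : ℕ := (tx.outputs.map Prod.snd).sum

/-- The client signature is valid if it was produced with the sender's key. -/
def Tx.SigValid (tx : Tx) : Prop := tx.signer = some tx.sender

/-- `p` is cited as a parent by `c`. -/
def IsParent (p c : Tx) : Prop := ∃ ix, (p.id, ix) ∈ c.inputs

/-- Two different transactions that spend the same output of the same parent. -/
def DoubleSpend (a b : Tx) : Prop := a ≠ b ∧ ∃ x, x ∈ a.inputs ∧ x ∈ b.inputs

/-- Two transactions conflict if they double spend, or if one or both of them descend from
transactions that do. -/
def Conflict (tx tx' : Tx) : Prop :=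
  ∃ a a', Relation.ReflTransGen IsParent a tx ∧ Relation.ReflTransGen IsParent a' tx' ∧
    DoubleSpend a a'

/-! ### Signatures and contents -/

/-- Bit strings in the place of a threshold signature: the initial signature, the threshold
signature under the keys of epoch `keyEpoch` on the content given by the remaining fields, or a
string that is neither. -/
inductive Sig where
  | initial : Sig
  | threshold (keyEpoch proposer epoch num height : ℕ) (tx : Tx) (vp : Sig) (ops : List Sig) : Sig
  | other (k : ℕ) : Sig

/-- The default value `⊥`. -/
def Sig.bot : Sig := .other 0

/-- A signature content: the `num`-th transaction proposed by node `proposer` in epoch `epoch`, at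
height `height` of its chain, with the virtual parent signature and the official parent
signatures. -/
structure Content where
  proposer : ℕ
  epoch : ℕ
  num : ℕ
  height : ℕ
  tx : Tx
  vp : Sig
  ops : List Sig

/-- The threshold signature on a content under the keys of epoch `e`. -/
def Content.sig (e : ℕ) (c : Content) : Sig :=
  .threshold e c.proposer c.epoch c.num c.height c.tx c.vp c.ops

/-- The parameters of the protocol: `n` consensus nodes, at most `t` of them corrupted, at most
`maxNumTx` proposals per node and epoch, and the outputs of the initial transaction. -/
structure Params where
  n : ℕ
  t : ℕ
  maxNumTx : ℕ
  genesisOutputs : List (ℕ × ℕ)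

/-- The threshold `k = ⌈(n + t + 1) / 2⌉` of the signature scheme. -/
def Params.k (P : Params) : ℕ := ⌈((P.n : ℚ) + P.t + 1) / 2⌉₊

/-- The initial transaction; it spends nothing. -/
def Params.genesis (P : Params) : Tx where
  sender := 0
  inputs := []
  outputs := P.genesisOutputs
  fee := 0
  signer := none
  payload := 0

/-- The content of the initial signature. -/
def Params.genesisContent (P : Params) : Content where
  proposer := 0
  epoch := 0
  num := 0
  height := 0
  tx := P.genesis
  vp := Sig.bot
  ops := []

/-- Verification of a final signature against the public key of epoch `e`. The initial signature is
the valid signature (of epoch `0`) on the initial content. -/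
def Verify (P : Params) (e : ℕ) (σ : Sig) (c : Content) : Prop :=
  σ = c.sig e ∨ (e = 0 ∧ σ = .initial ∧ c = P.genesisContent)

/-! ### Attested proofs of seal -/

/-- An attested proof of seal (APS). A Type I APS consists of a signature and its content, a Type II
APS of two signatures and their contents, meant for consecutive heights of one chain. -/
inductive APS where
  | typeI (σ : Sig) (c : Content) : APS
  | typeII (σ : Sig) (c : Content) (σ' : Sig) (c' : Content) : APS

/-- The content of the transaction that an APS is for. -/
def APS.content : APS → Content
  | .typeI _ c => c
  | .typeII _ c _ _ => c

/-- The transaction that an APS is for. -/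
def APS.tx (A : APS) : Tx := A.content.tx

/-- The signatures included in an APS. -/
def APS.sigs : APS → List Sig
  | .typeI σ _ => [σ]
  | .typeII σ _ σ' _ => [σ, σ']

/-- Validity: the signatures verify and, for Type II, the second one is for the next height of the
same chain and links to the first one as its virtual parent. -/
def APS.Valid (P : Params) : APS → Prop
  | .typeI σ c => Verify P c.epoch σ c
  | .typeII σ c σ' c' => Verify P c.epoch σ c ∧ Verify P c'.epoch σ' c' ∧
      c'.proposer = c.proposer ∧ c'.height = c.height + 1 ∧ c'.vp = σ

/-! ### Proposals -/

/-- A signature together with all of its content except the transaction and the official parent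
signatures; with those of the proposal it accompanies it forms a Type I APS. -/
structure TxProof where
  sig : Sig
  proposer : ℕ
  epoch : ℕ
  num : ℕ
  height : ℕ
  vp : Sig

/-- A `PROPOSE` message. -/
structure Proposal where
  chain : ℕ
  epoch : ℕ
  num : ℕ
  height : ℕ
  tx : Tx
  vp : Sig
  ops : List Sig
  opContents : List Content
  /-- epoch and number of the proposal of the virtual parent -/
  vpEpoch : ℕ
  vpNum : ℕ
  /-- completion proof for the previous proposal, by a conflict: its epoch, its number, and a
  conflicting transaction -/
  prevProof : Option (ℕ × ℕ × Tx)
  /-- an APS for the proposed transaction, if there is one already -/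
  txProof : Option TxProof

/-- The content that a vote for the proposal signs. -/
def Proposal.content (p : Proposal) : Content where
  proposer := p.chain
  epoch := p.epoch
  num := p.num
  height := p.height
  tx := p.tx
  vp := p.vp
  ops := p.ops

/-- The signatures carried by a proposal. -/
def Proposal.sigs (p : Proposal) : List Sig :=
  p.vp :: (p.ops ++ (p.txProof.map TxProof.sig).toList)

/-! ### The local state of a node and its procedures -/

/-- The local state of a node. Records that only serve to select the next own proposal are not
kept, since any proposal may be made in this model. -/
structure NodeState where
  /-- current epoch -/
  epoch : ℕ
  /-- accepted signatures, with contents -/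
  sigAccept : Sig → Option Content
  /-- accepted transactions, with signatures -/
  txAccept : TxId → Option (Tx × List Sig)
  /-- the transaction recorded as spending a given output -/
  children : TxId × ℕ → Option Tx
  /-- transactions known to conflict, each with a conflicting one -/
  conflicting : TxId → Option Tx
  /-- the one signature accepted at (chain, height): transaction identity, signature, virtual
  parent -/
  heightAccept : ℕ × ℕ → Option (TxId × Sig × Sig)
  /-- the same for locked heights -/
  heightAcceptLock : ℕ × ℕ → Option (TxId × Sig × Sig)
  /-- top locked height of each chain -/
  heightLock : ℕ → ℕ
  /-- content of the proposal with given chain, epoch and number -/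
  proposals : ℕ × ℕ × ℕ → Option Content
  /-- the received proposal message with given chain, epoch and number (for its completion proof) -/
  proofs : ℕ × ℕ × ℕ → Option Proposal
  /-- received proposals, to be processed when their conditions are met -/
  pending : Set Proposal
  /-- `numLock e j`: the first so many proposals of node `j` in epoch `e` are complete; initially
  `0` in epoch `1` and `-1` in later epochs -/
  numLock : ℕ → ℕ → ℤ
  /-- last proposal of node `j` voted for: epoch, number, transaction -/
  numVoted : ℕ → Option (ℕ × ℕ × Tx)

/-- The initial local state. -/
def NodeState.init (P : Params) : NodeState where
  epoch := 1
  sigAccept := Function.update (fun _ => none) Sig.initial (some P.genesisContent)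
  txAccept := Function.update (fun _ => none) P.genesis.id (some (P.genesis, [Sig.initial]))
  children := fun _ => none
  conflicting := fun _ => none
  heightAccept := fun x => if x.2 = 0 then some (P.genesis.id, Sig.initial, Sig.bot) else none
  heightAcceptLock := fun x => if x.2 = 0 then some (P.genesis.id, Sig.initial, Sig.bot) else none
  heightLock := fun _ => 0
  proposals := fun x => if x.2 = (0, 0) then some P.genesisContent else none
  proofs := fun _ => none
  pending := ∅
  numLock := fun e _ => if e = 1 then 0 else -1
  numVoted := fun _ => none

/-- The node has accepted the transaction. -/
def NodeState.Accepted (s : NodeState) (tx : Tx) : Prop :=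
  ∃ σs, s.txAccept tx.id = some (tx, σs)

/-- Add a signature to the entry of a transaction in the record of accepted transactions. -/
def addAccepted (f : TxId → Option (Tx × List Sig)) (tx : Tx) (σ : Sig) :
    TxId → Option (Tx × List Sig) :=
  Function.update f tx.id <| match f tx.id with
    | none => some (tx, [σ])
    | some (tx₀, σs) => some (tx₀, σs ++ [σ])

/-- Record a transaction as the spender of all of its inputs. -/
def recordSpends (f : TxId × ℕ → Option Tx) (tx : Tx) : TxId × ℕ → Option Tx :=
  fun x => if x ∈ tx.inputs then some tx else f x

/-- The procedure `Accept`; the Boolean tells whether the signature is accepted now. -/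
def NodeState.accept (P : Params) (s : NodeState) (σ : Sig) (c : Content) : NodeState × Bool :=
  if c.epoch ≤ s.epoch ∧ Verify P c.epoch σ c then
    if s.sigAccept σ = none then
      ({ s with
          sigAccept := Function.update s.sigAccept σ (some c)
          txAccept := addAccepted s.txAccept c.tx σ
          heightAccept :=
            if s.heightAccept (c.proposer, c.height) = none then
              Function.update s.heightAccept (c.proposer, c.height) (some (c.tx.id, σ, c.vp))
            else s.heightAccept
          proposals := Function.update s.proposals (c.proposer, c.epoch, c.num) (some c)
          children := recordSpends s.children c.tx }, true)
    else (s, true)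
  else (s, false)

/-- `Accept`, for a list of signatures with contents; the Boolean is the conjunction. -/
def NodeState.acceptAll (P : Params) (s : NodeState) : List (Sig × Content) → NodeState × Bool
  | [] => (s, true)
  | (σ, c) :: l =>
    let r := s.accept P σ c
    let r' := r.1.acceptAll P l
    (r'.1, r.2 && r'.2)

/-- The loop of `CheckTx` over the inputs of `tx`; `amt` is the input amount so far. -/
def checkInputs (tx : Tx) : List (TxId × ℕ) → ℕ → NodeState → NodeState × Bool × Option Tx
  | [], amt, s => (s, decide (amt = tx.outAmount + tx.fee), none)
  | (opId, ix) :: rest, amt, s =>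
    match s.txAccept opId with
    | none => (s, false, none)
    | some (op, _) =>
      match op.outputs[ix]? with
      | none => (s, false, none)
      | some (receiver, a) =>
        if receiver ≠ tx.sender then (s, false, none)
        else
          match s.children (opId, ix) with
          | none =>
            checkInputs tx rest (amt + a)
              { s with children := Function.update s.children (opId, ix) (some tx) }
          | some tx' =>
            if tx'.id = tx.id then checkInputs tx rest (amt + a) s
            else
              ({ s with conflicting := Function.update s.conflicting tx.id (some tx') },
                false, some tx')

/-- The procedure `CheckTx`: true if the transaction is accepted already, or is signed correctly,
has accepted parents, consistent addresses and balances, and no recorded double spending. Otherwise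
the last component may name a conflicting transaction. -/
def NodeState.checkTx (s : NodeState) (tx : Tx) : NodeState × Bool × Option Tx :=
  if s.txAccept tx.id ≠ none then (s, true, none)
  else if ¬ tx.SigValid then (s, false, none)
  else
    match s.conflicting tx.id with
    | some tx' => (s, false, some tx')
    | none => checkInputs tx tx.inputs 0 s

/-- The procedure `CheckProofTx`: true if the transaction is fine, is accepted already, or comes
with a valid APS in spite of a conflict. -/
def NodeState.checkProofTx (P : Params) (s : NodeState) (ok : Bool) (conf : Option Tx) (tx : Tx)
    (ops : List Sig) (proof : Option TxProof) : NodeState × Bool :=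
  if ok = true ∨ s.txAccept tx.id ≠ none then (s, true)
  else
    match conf, proof with
    | some _, some q => s.accept P q.sig ⟨q.proposer, q.epoch, q.num, q.height, tx, q.vp, ops⟩
    | _, _ => (s, false)

/-- The procedure `ConflictTxCheck`: do these transactions double spend an output? -/
def NodeState.conflictTxCheck (s : NodeState) (tx tx' : Tx) : NodeState × Bool :=
  if tx.SigValid ∧ tx'.SigValid ∧ tx.sender = tx'.sender ∧ DoubleSpend tx tx' then
    ({ s with conflicting := Function.update s.conflicting tx.id (some tx') }, true)
  else (s, false)

/-- The procedure `ProofCheck`, applied to a proposal `p` of number at least `2`: is the preceding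
proposal of the same chain and epoch complete? -/
def NodeState.proofCheck (P : Params) (s : NodeState) (p : Proposal) : NodeState × Bool :=
  let vpContent := s.proposals (p.chain, p.vpEpoch, p.vpNum)
  if p.num < 2 then (s, false)
  else if p.epoch = p.vpEpoch ∧ p.num = p.vpNum + 1 ∧ vpContent ≠ none then
    (s, decide (∃ c, vpContent = some c ∧ Verify P p.epoch p.vp c))
  else
    match p.prevProof, s.proposals (p.chain, p.epoch, p.num - 1) with
    | some (e, m, tx'), some c =>
      if e = p.epoch ∧ m = p.num - 1 then s.conflictTxCheck c.tx tx' else (s, false)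
    | _, _ => (s, false)

/-- Set `numLock e j`. -/
def NodeState.setNumLock (s : NodeState) (e j : ℕ) (z : ℤ) : NodeState :=
  { s with numLock := Function.update s.numLock e (Function.update (s.numLock e) j z) }

/-- Reception of a proposal message; a message for a later epoch waits. -/
def NodeState.recvProposal (P : Params) (s : NodeState) (p : Proposal) : NodeState :=
  if p.epoch ≤ s.epoch ∧ s.proposals (p.chain, p.epoch, p.num) = none ∧
      1 ≤ p.num ∧ p.num ≤ P.maxNumTx ∧ 1 ≤ p.height ∧ 1 ≤ p.chain ∧ p.chain ≤ P.n then
    { s with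
        proposals := Function.update s.proposals (p.chain, p.epoch, p.num) (some p.content)
        proofs := Function.update s.proofs (p.chain, p.epoch, p.num) (some p)
        pending := insert p s.pending }
  else s

/-- The last part of the processing of a proposal: `Accept` the official parents, check the
transaction, and vote if all is well and the proposal is of the current epoch. The Boolean tells
whether the node votes. -/
def NodeState.checkAndVote (P : Params) (s : NodeState) (p : Proposal) : NodeState × Bool :=
  let r := s.acceptAll P (p.ops.zip p.opContents)
  if r.2 = true then
    let q := r.1.checkTx p.tx
    let w := q.1.checkProofTx P q.2.1 q.2.2 p.tx p.ops p.txProof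
    if (q.2.1 = true ∨ w.2 = true) ∧ p.epoch = w.1.epoch then
      ({ w.1 with numVoted :=
          Function.update w.1.numVoted p.chain (some (p.epoch, p.num, p.tx)) }, true)
    else (w.1, false)
  else (r.1, false)

/-- Processing of a received proposal. Its virtual parent has to be accepted, as the only signature
accepted at the preceding height of the same chain, the chain has to be locked up to two heights
below, and all preceding proposals of the epoch have to be complete. -/
def NodeState.processProposal (P : Params) (s : NodeState) (p : Proposal) : NodeState × Bool :=
  match s.proposals (p.chain, p.vpEpoch, p.vpNum) with
  | none => (s, false)
  | some c =>
    let r := s.accept P p.vp c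
    if r.2 = true ∧ c.height + 1 = p.height ∧ (c.proposer = p.chain ∨ c = P.genesisContent) ∧
        (∃ i v, r.1.heightAccept (p.chain, c.height) = some (i, p.vp, v)) ∧
        r.1.heightLock p.chain = p.height - 2 ∧
        r.1.numLock p.epoch p.chain = (p.num : ℤ) - 1 ∧
        p.ops.length = p.opContents.length then
      r.1.checkAndVote P p
    else (r.1, false)

/-- Processing of a submitted transaction with the signatures and contents of its parents. -/
def NodeState.newTx (P : Params) (s : NodeState) (tx : Tx) (ops : List Sig) (cs : List Content) :
    NodeState :=
  if ops.length = cs.length ∧ 1 ≤ ops.length ∧ s.conflicting tx.id = none then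
    let r := s.acceptAll P (ops.zip cs)
    if r.2 = true then (r.1.checkTx tx).1 else r.1
  else s

/-- Reception of an APS: `Accept` all that it includes. -/
def NodeState.recvAPS (P : Params) (s : NodeState) : APS → NodeState
  | .typeI σ c => (s.accept P σ c).1
  | .typeII σ c σ' c' => ((s.accept P σ c).1.accept P σ' c').1

/-- The steps of a consensus node that are neither a reception of an APS, of a transaction or of a
proposal, nor the processing of a proposal. Loops of the protocol are split into their iterations,
which may happen at any time. -/
inductive InternalStep (P : Params) : NodeState → NodeState → Prop
  /-- one more locked height in chain `j` -/
  | lock (s : NodeState) (j : ℕ) (i₁ : TxId) (σ₁ v₁ : Sig) (i₂ : TxId) (σ₂ v₂ : Sig) (i₀ : TxId)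
      (σ₀ v₀ : Sig)
      (h₁ : s.heightAccept (j, s.heightLock j + 1) = some (i₁, σ₁, v₁))
      (h₂ : s.heightAccept (j, s.heightLock j + 2) = some (i₂, σ₂, v₂))
      (h₀ : s.heightAcceptLock (j, s.heightLock j) = some (i₀, σ₀, v₀))
      (hv : v₂ = σ₁ ∧ v₁ = σ₀) :
      InternalStep P s { s with
        heightAcceptLock :=
          Function.update s.heightAcceptLock (j, s.heightLock j + 1) (some (i₁, σ₁, v₁))
        heightLock := Function.update s.heightLock j (s.heightLock j + 1) }
  /-- one more complete proposal of node `j` in epoch `e`, by the proof attached to the next -/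
  | complete (s : NodeState) (j e : ℕ) (m : ℕ) (p : Proposal)
      (hj : s.numVoted j ≠ none) (hm : s.numLock e j = m)
      (hp : s.proofs (j, e, m + 2) = some p) (hc : s.proposals (j, e, m + 1) ≠ none)
      (hok : (s.proofCheck P p).2 = true) :
      InternalStep P s ((s.proofCheck P p).1.setNumLock e j (m + 1))
  /-- a failed check of the proof attached to a proposal -/
  | incomplete (s : NodeState) (j e m : ℕ) (p : Proposal) (hp : s.proofs (j, e, m) = some p)
      (hok : (s.proofCheck P p).2 = false) :
      InternalStep P s (s.proofCheck P p).1
  /-- the last proposal of `j` voted for, of epoch `e'`, is complete -/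
  | carryComplete (s : NodeState) (j e' m : ℕ) (tx : Tx)
      (hj : s.numVoted j = some (e', m, tx)) (hm : (m : ℤ) ≤ s.numLock e' j) :
      InternalStep P s (s.setNumLock s.epoch j (max (s.numLock s.epoch j) 0))
  /-- the last proposal of `j` voted for is proposed again as the first one of a later epoch `e` -/
  | carryAgain (s : NodeState) (j e e' m : ℕ) (tx : Tx) (c : Content)
      (hj : s.numVoted j = some (e', m, tx)) (he : e' < e ∧ e ≤ s.epoch)
      (hp : s.proofs (j, e, 2) ≠ none) (hc : s.proposals (j, e, 1) = some c) (htx : tx = c.tx) :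
      InternalStep P s (s.setNumLock e j (max (s.numLock e j) 0))
  /-- that proposal has been completed in such an epoch -/
  | carryOver (s : NodeState) (j e e' m : ℕ) (tx : Tx)
      (hj : s.numVoted j = some (e', m, tx)) (he : e' < e ∧ e ≤ s.epoch)
      (hm : 1 ≤ s.numLock e j) :
      InternalStep P s (s.setNumLock s.epoch j (max (s.numLock s.epoch j) 0))
  /-- a transaction is checked before it is proposed -/
  | select (s : NodeState) (tx : Tx) : InternalStep P s (s.checkTx tx).1
  /-- the own transaction `tx` is reported to conflict with `tx'` -/
  | conflict (s : NodeState) (tx tx' : Tx) : InternalStep P s (s.conflictTxCheck tx tx').1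

/-! ### Executions -/

/-- A global state. The nodes are the `n` consensus nodes and the RPC nodes, which form a type `R`;
`partials` holds the partial signatures issued so far by honest nodes: `(i, e, c)` is the one of
node `i` on the content `c`, with its key share of epoch `e`. -/
structure Global (P : Params) (R : Type*) where
  node : Fin P.n ⊕ R → NodeState
  corrupted : Set (Fin P.n ⊕ R)
  partials : Set (Fin P.n × ℕ × Content)

variable {P : Params} {R : Type*}

/-- The initial global state. -/
def Global.init (P : Params) (R : Type*) : Global P R where
  node := fun _ => NodeState.init P
  corrupted := ∅
  partials := ∅

/-- The partial signature of node `i` on `c` under its key share of epoch `e` can be had: the node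
has issued it, or is corrupted. -/
def Global.HasPartial (g : Global P R) (i : Fin P.n) (e : ℕ) (c : Content) : Prop :=
  Sum.inl i ∈ g.corrupted ∨ (i, e, c) ∈ g.partials

/-- The strings that can have been generated in a global state: a threshold signature only by
combination of the partial signatures of at least `k` distinct nodes on the same content. (An
aggregation in layers that uses at least `k` partial signatures in total is a special case.) -/
inductive Global.Generated (g : Global P R) : Sig → Prop
  | initial : g.Generated Sig.initial
  | other (k : ℕ) : g.Generated (Sig.other k)
  | combine (e : ℕ) (c : Content) (T : Finset (Fin P.n)) (hT : P.k ≤ T.card)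
      (h : ∀ i ∈ T, g.HasPartial i e c) : g.Generated (c.sig e)

/-- Replace the local state of one node. -/
def Global.setNode (g : Global P R) (a : Fin P.n ⊕ R) (s : NodeState) : Global P R :=
  { g with node := Function.update g.node a s }

/-- The global state after node `a` has received an APS. -/
def Global.receive (g : Global P R) (a : Fin P.n ⊕ R) (A : APS) : Global P R :=
  g.setNode a ((g.node a).recvAPS P A)

/-- One step of an execution. Every signature in a delivered message must have been generated;
apart from that, messages are arbitrary. -/
inductive Step : Global P R → Global P R → Prop
  /-- the adversary corrupts a further node; at most `t` consensus nodes in total -/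
  | corrupt (g : Global P R) (a : Fin P.n ⊕ R)
      (h : {i | Sum.inl i ∈ insert a g.corrupted}.ncard ≤ P.t) :
      Step g { g with corrupted := insert a g.corrupted }
  /-- an honest node receives an APS, or aggregates one itself -/
  | recvAPS (g : Global P R) (a : Fin P.n ⊕ R) (ha : a ∉ g.corrupted) (A : APS)
      (hA : ∀ σ ∈ A.sigs, g.Generated σ) : Step g (g.receive a A)
  /-- an honest node receives a transaction with the signatures of its parents -/
  | recvTx (g : Global P R) (a : Fin P.n ⊕ R) (ha : a ∉ g.corrupted) (tx : Tx) (ops : List Sig)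
      (cs : List Content) (hops : ∀ σ ∈ ops, g.Generated σ) :
      Step g (g.setNode a ((g.node a).newTx P tx ops cs))
  /-- an honest node enters the next epoch -/
  | nextEpoch (g : Global P R) (a : Fin P.n ⊕ R) (ha : a ∉ g.corrupted) :
      Step g (g.setNode a { g.node a with epoch := (g.node a).epoch + 1 })
  /-- an honest consensus node receives a proposal -/
  | recvProposal (g : Global P R) (i : Fin P.n) (hi : Sum.inl i ∉ g.corrupted) (p : Proposal)
      (hp : ∀ σ ∈ p.sigs, g.Generated σ) :
      Step g (g.setNode (.inl i) ((g.node (.inl i)).recvProposal P p))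
  /-- an honest consensus node does an internal step -/
  | internal (g : Global P R) (i : Fin P.n) (hi : Sum.inl i ∉ g.corrupted) (s : NodeState)
      (hs : InternalStep P (g.node (.inl i)) s) : Step g (g.setNode (.inl i) s)
  /-- an honest consensus node processes a proposal and does not vote -/
  | reject (g : Global P R) (i : Fin P.n) (hi : Sum.inl i ∉ g.corrupted) (p : Proposal)
      (hp : p ∈ (g.node (.inl i)).pending)
      (hv : ((g.node (.inl i)).processProposal P p).2 = false) :
      Step g (g.setNode (.inl i) ((g.node (.inl i)).processProposal P p).1)
  /-- an honest consensus node processes a proposal and votes: it issues its partial signature -/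
  | vote (g : Global P R) (i : Fin P.n) (hi : Sum.inl i ∉ g.corrupted) (p : Proposal)
      (hp : p ∈ (g.node (.inl i)).pending)
      (hv : ((g.node (.inl i)).processProposal P p).2 = true) :
      Step g { g.setNode (.inl i) ((g.node (.inl i)).processProposal P p).1 with
        partials := insert (i, p.epoch, p.content) g.partials }

/-- `g'` can follow `g` in an execution. -/
def Reaches (g g' : Global P R) : Prop := Relation.ReflTransGen Step g g'

/-- `g` occurs in an execution. -/
def Reachable (g : Global P R) : Prop := Reaches (Global.init P R) g

end

end Ocior

namespace Ocior

open scoped Classical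

/-! ### Uniqueness of identities and signatures -/

/-! Call a transaction sealed once some verifying signature for it can be generated. Accepted
transactions are sealed, and so are those with a generated valid APS. Hence both statements about
conflicts reduce to `Inv.not_conflict`: transactions sealed in the same global state do not
conflict.

Plain quorum intersection is not enough, because an honest node may vote for both sides of a double
spending: an APS lets it vote for a transaction in spite of an earlier vote. So only first-hand
votes are counted, those for a transaction not yet sealed, for which the node must have relied on
its own check. The signature that first seals a transaction consists of first-hand votes and partial
signatures of corrupted nodes, and the invariant `Inv` remembers this quorum forever.

First-hand votes of one node never double spend (`Inv.not_doubleSpend_of_checked`): the check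
records the spender of each input, and only a sealed transaction can overwrite a record (`Evolves`).
Two quorums share more than `t` nodes, hence an honest one (`exists_honest_mem_inter`), so sealed
transactions do not double spend. Ancestors are covered because a first-hand voter has accepted the
parents, which makes them sealed as well (`Inv.sealed_ancestor`).

Acceptance on receipt of an APS is a local matter (`NodeInv.accepted_recvAPS`); it is irrevocable
since entries of `txAccept` never disappear. -/

theorem Tx.id_injective : Function.Injective Tx.id := by
  rintro ⟨⟩ ⟨⟩ h
  simpa [Tx.id] using h

theorem Content.sig_inj {e e' : ℕ} {c c' : Content} (h : c.sig e = c'.sig e') :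
    e = e' ∧ c = c' := by
  cases c
  cases c'
  simpa [Content.sig] using h

/-- A threshold signature is a term that contains its content, and the initial signature is no such
term. This is what identifies a signature already on record with the one just received. -/
theorem Verify.content_unique {P : Params} {e e' : ℕ} {σ : Sig} {c c' : Content}
    (h : Verify P e σ c) (h' : Verify P e' σ c') : c = c' := by
  rcases h with rfl | ⟨-, rfl, rfl⟩ <;> rcases h' with h' | ⟨-, h', rfl⟩
  · exact (Content.sig_inj h').2
  · simp [Content.sig] at h'
  · simp [Content.sig] at h'
  · rfl

/-! ### Sealed transactions and the invariant of a node -/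

/-- A signature that verifies for a content with transaction `tx` is available. -/
def Sealed (P : Params) (G : Sig → Prop) (tx : Tx) : Prop :=
  ∃ σ c, Verify P c.epoch σ c ∧ G σ ∧ c.tx = tx

theorem Sealed.mono {P : Params} {G G' : Sig → Prop} (hG : ∀ σ, G σ → G' σ) {tx : Tx}
    (h : Sealed P G tx) : Sealed P G' tx :=
  let ⟨σ, c, h₁, h₂, h₃⟩ := h
  ⟨σ, c, h₁, hG σ h₂, h₃⟩

/-- The invariant of a local state when the signatures in `G` are available. -/
structure NodeInv (P : Params) (G : Sig → Prop) (s : NodeState) : Prop where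
  accepted : ∀ id tx σs, s.txAccept id = some (tx, σs) → tx.id = id ∧ Sealed P G tx
  sig : ∀ σ c, s.sigAccept σ = some c → Verify P c.epoch σ c ∧ s.Accepted c.tx
  pending : ∀ p ∈ s.pending, ∀ σ ∈ p.sigs, G σ

/-- Accepted transactions remain accepted, and a recorded spender is only ever replaced by a sealed
one. -/
structure Evolves (P : Params) (G : Sig → Prop) (s s' : NodeState) : Prop where
  accepted : ∀ id tx σs, s.txAccept id = some (tx, σs) → ∃ σs', s'.txAccept id = some (tx, σs')
  children : ∀ x y, s.children x = some y →
    ∃ y', s'.children x = some y' ∧ (y' = y ∨ Sealed P G y')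

variable {P : Params} {G : Sig → Prop} {s s' s'' : NodeState}

theorem NodeInv.mono {G' : Sig → Prop} (hG : ∀ σ, G σ → G' σ) (h : NodeInv P G s) :
    NodeInv P G' s where
  accepted id tx σs hx := ⟨(h.accepted id tx σs hx).1, (h.accepted id tx σs hx).2.mono hG⟩
  sig := h.sig
  pending p hp σ hσ := hG σ (h.pending p hp σ hσ)

theorem NodeInv.sealed (h : NodeInv P G s) {tx : Tx} (ha : s.Accepted tx) : Sealed P G tx :=
  let ⟨σs, hσ⟩ := ha
  (h.accepted _ _ σs hσ).2

theorem NodeInv.sealed_of_ne_none (h : NodeInv P G s) {tx : Tx} (ha : s.txAccept tx.id ≠ none) :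
    Sealed P G tx := by
  obtain ⟨⟨tx', σs⟩, hx⟩ := Option.ne_none_iff_exists'.1 ha
  obtain ⟨h₁, h₂⟩ := h.accepted _ _ _ hx
  rwa [← Tx.id_injective h₁]

theorem Evolves.refl (s : NodeState) : Evolves P G s s where
  accepted _ _ σs h := ⟨σs, h⟩
  children _ y h := ⟨y, h, .inl rfl⟩

theorem Evolves.trans (h : Evolves P G s s') (h' : Evolves P G s' s'') : Evolves P G s s'' where
  accepted id tx σs hx := by
    obtain ⟨σs', hx'⟩ := h.accepted id tx σs hx
    exact h'.accepted id tx σs' hx'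
  children x y hx := by
    obtain ⟨y', hx', hy'⟩ := h.children x y hx
    obtain ⟨y'', hx'', rfl | hy''⟩ := h'.children x y' hx'
    · exact ⟨_, hx'', hy'⟩
    · exact ⟨_, hx'', .inr hy''⟩

theorem Evolves.accepted_of (h : Evolves P G s s') {tx : Tx} (ha : s.Accepted tx) :
    s'.Accepted tx :=
  let ⟨σs, hσ⟩ := ha
  h.accepted _ _ σs hσ

/-- A transition of a local state that preserves the invariant. -/
def Sound (P : Params) (G : Sig → Prop) (s s' : NodeState) : Prop :=
  NodeInv P G s' ∧ Evolves P G s s'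

theorem Sound.refl (h : NodeInv P G s) : Sound P G s s := ⟨h, .refl s⟩

theorem Sound.trans (h : Sound P G s s') (h' : Sound P G s' s'') : Sound P G s s'' :=
  ⟨h'.1, h.2.trans h'.2⟩

/-- A change of the fields that the invariant does not mention is sound. -/
theorem Sound.of_eq (h : NodeInv P G s) (h₁ : s'.txAccept = s.txAccept)
    (h₂ : s'.sigAccept = s.sigAccept) (h₃ : s'.pending = s.pending)
    (h₄ : s'.children = s.children) : Sound P G s s' := by
  refine ⟨⟨?_, ?_, ?_⟩, ⟨?_, ?_⟩⟩
  · rw [h₁]; exact h.accepted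
  · rw [h₂]; unfold NodeState.Accepted; rw [h₁]; exact h.sig
  · rw [h₃]; exact h.pending
  · rw [h₁]; exact (Evolves.refl (P := P) (G := G) s).accepted
  · rw [h₄]; exact (Evolves.refl s).children

/-! ### The procedures of a node -/

theorem addAccepted_of_some {f : TxId → Option (Tx × List Sig)} {id : TxId} {tx₀ : Tx}
    {σs : List Sig} (h : f id = some (tx₀, σs)) (tx : Tx) (σ : Sig) :
    ∃ σs', addAccepted f tx σ id = some (tx₀, σs') := by
  unfold addAccepted
  by_cases hid : id = tx.id
  · subst hid
    simp [h]
  · simp [hid, h]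

theorem addAccepted_cases {f : TxId → Option (Tx × List Sig)} {id : TxId} {tx tx₀ : Tx} {σ : Sig}
    {σs : List Sig} (h : addAccepted f tx σ id = some (tx₀, σs)) :
    (id = tx.id ∧ tx₀ = tx) ∨ ∃ σs', f id = some (tx₀, σs') := by
  unfold addAccepted at h
  by_cases hid : id = tx.id
  · subst hid
    rw [Function.update_self] at h
    cases hf : f tx.id with
    | none => simp_all
    | some q => obtain ⟨a, b⟩ := q; simp_all
  · rw [Function.update_of_ne hid] at h
    exact .inr ⟨_, h⟩

/-- An existing entry keeps its old transaction; by the invariant that one has the same hash, hence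
is `tx`. -/
theorem NodeInv.addAccepted_self (h : NodeInv P G s) (tx : Tx) (σ : Sig) :
    ∃ σs, addAccepted s.txAccept tx σ tx.id = some (tx, σs) := by
  cases hf : s.txAccept tx.id with
  | none => simp [addAccepted, hf]
  | some q =>
    obtain ⟨tx₀, σs⟩ := q
    obtain rfl := Tx.id_injective (h.accepted _ _ _ hf).1
    exact addAccepted_of_some hf _ σ

/-- The accepted signature itself seals `c.tx`, so overwriting the recorded spenders with `c.tx` is
a change that `Evolves` permits. -/
theorem NodeInv.accept_sound (h : NodeInv P G s) {σ : Sig} (hσ : G σ) (c : Content) :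
    Sound P G s (s.accept P σ c).1 := by
  unfold NodeState.accept
  by_cases h₁ : c.epoch ≤ s.epoch ∧ Verify P c.epoch σ c
  swap
  · rw [if_neg h₁]
    exact .refl h
  rw [if_pos h₁]
  by_cases h₂ : s.sigAccept σ = none
  · rw [if_pos h₂]
    have hs : Sealed P G c.tx := ⟨σ, c, h₁.2, hσ, rfl⟩
    refine ⟨⟨?_, ?_, h.pending⟩, ⟨?_, ?_⟩⟩
    · rintro id tx σs hx
      rcases addAccepted_cases hx with ⟨rfl, rfl⟩ | ⟨σs', hx'⟩
      · exact ⟨rfl, hs⟩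
      · exact h.accepted _ _ _ hx'
    · intro τ d hd
      dsimp only at hd
      by_cases hτ : τ = σ
      · subst hτ
        rw [Function.update_self, Option.some.injEq] at hd
        subst hd
        exact ⟨h₁.2, h.addAccepted_self _ _⟩
      · rw [Function.update_of_ne hτ] at hd
        obtain ⟨hv, σs, ha⟩ := h.sig τ d hd
        exact ⟨hv, addAccepted_of_some ha _ _⟩
    · intro id tx σs hx
      exact addAccepted_of_some hx _ _
    · intro x y hx
      by_cases hm : x ∈ c.tx.inputs
      · exact ⟨c.tx, by simp [recordSpends, hm], .inr hs⟩
      · exact ⟨y, by simp [recordSpends, hm, hx], .inl rfl⟩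
  · rw [if_neg h₂]
    exact .refl h

theorem verify_of_accept_true {σ : Sig} {c : Content} (h : (s.accept P σ c).2 = true) :
    Verify P c.epoch σ c := by
  by_contra hv
  simp [NodeState.accept, hv] at h

/-- If `σ` is on record already, `accept` changes nothing; then the content stored with `σ` must be
`c`, and its transaction was accepted along with it. -/
theorem NodeInv.accepted_accept (h : NodeInv P G s) {σ : Sig} {c : Content} (he : c.epoch ≤ s.epoch)
    (hv : Verify P c.epoch σ c) : (s.accept P σ c).1.Accepted c.tx := by
  unfold NodeState.accept
  rw [if_pos ⟨he, hv⟩]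
  by_cases h₂ : s.sigAccept σ = none
  · rw [if_pos h₂]
    exact h.addAccepted_self _ _
  · rw [if_neg h₂]
    obtain ⟨d, hd⟩ := Option.ne_none_iff_exists'.1 h₂
    obtain ⟨hv', ha⟩ := h.sig σ d hd
    obtain rfl := hv.content_unique hv'
    exact ha

theorem NodeInv.acceptAll_sound {l : List (Sig × Content)} (hl : ∀ q ∈ l, G q.1) :
    ∀ {s : NodeState}, NodeInv P G s → Sound P G s (s.acceptAll P l).1 := by
  induction l with
  | nil => exact fun h => .refl h
  | cons q l ih =>
    intro s h
    obtain ⟨σ, c⟩ := q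
    have h₁ := h.accept_sound (hl _ List.mem_cons_self) c
    exact h₁.trans (ih (fun q hq => hl q (List.mem_cons_of_mem _ hq)) h₁.1)

theorem NodeInv.acceptAll_zip_sound (h : NodeInv P G s) {ops : List Sig} (hops : ∀ σ ∈ ops, G σ)
    (cs : List Content) : Sound P G s (s.acceptAll P (ops.zip cs)).1 :=
  h.acceptAll_sound fun q hq => hops _ (List.of_mem_zip (a := q.1) (b := q.2) hq).1

/-- The loop writes only to vacant entries of `children`. Entries made before a failure are not
undone, which is harmless: only entries present at the start are constrained. -/
theorem NodeInv.checkInputs_sound (tx : Tx) (l : List (TxId × ℕ)) :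
    ∀ {s : NodeState} (amt : ℕ), NodeInv P G s → Sound P G s (checkInputs tx l amt s).1 := by
  induction l with
  | nil => exact fun _ h => .refl h
  | cons x l ih =>
    intro s amt h
    obtain ⟨opId, ix⟩ := x
    rw [checkInputs]
    split
    · exact .refl h
    · split
      · exact .refl h
      · split_ifs
        · exact .refl h
        · split
          · rename_i hn
            refine Sound.trans (s' := { s with
              children := Function.update s.children (opId, ix) (some tx) }) ?_ (ih _ ?_)
            · refine ⟨⟨h.accepted, h.sig, h.pending⟩, ⟨(Evolves.refl (P := P) (G := G) s).accepted, ?_⟩⟩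
              intro x y hx
              have : x ≠ (opId, ix) := by rintro rfl; simp [hn] at hx
              exact ⟨y, by simp [this, hx], .inl rfl⟩
            · exact ⟨h.accepted, h.sig, h.pending⟩
          · split_ifs
            · exact ih _ h
            · exact .of_eq h rfl rfl rfl rfl

/-- If the loop of `CheckTx` succeeds, then the parents are accepted, and `tx` is the recorded
spender of its inputs, which have had no other before. -/
theorem checkInputs_true {tx : Tx} {l : List (TxId × ℕ)} :
    ∀ {s : NodeState} {amt : ℕ}, (checkInputs tx l amt s).2.1 = true →
      (checkInputs tx l amt s).1.txAccept = s.txAccept ∧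
      (∀ x, s.children x = some tx → (checkInputs tx l amt s).1.children x = some tx) ∧
      ∀ x ∈ l, s.txAccept x.1 ≠ none ∧ (checkInputs tx l amt s).1.children x = some tx ∧
        ∀ y, s.children x = some y → y = tx := by
  induction l with
  | nil => intro s amt h; simp [checkInputs]
  | cons x l ih =>
    intro s amt h
    obtain ⟨opId, ix⟩ := x
    rw [checkInputs] at h ⊢
    rcases hop : s.txAccept opId with _ | ⟨op, σs⟩
    · simp [hop] at h
    rcases hout : op.outputs[ix]? with _ | ⟨receiver, a⟩
    · simp [hop, hout] at h
    by_cases hr : receiver ≠ tx.sender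
    · simp [hop, hout, hr] at h
    cases hs : s.children (opId, ix) with
    | none =>
      simp only [hop, hout, if_neg hr, hs] at h ⊢
      obtain ⟨h₁, h₂, h₃⟩ := ih h
      refine ⟨h₁, fun x hx => h₂ x ?_, ?_⟩
      · have : x ≠ (opId, ix) := by rintro rfl; simp [hs] at hx
        simp [this, hx]
      · intro x hx
        rcases List.mem_cons.1 hx with rfl | hx
        · exact ⟨by simp [hop], h₂ _ (by simp), by simp [hs]⟩
        · obtain ⟨h₄, h₅, h₆⟩ := h₃ x hx
          refine ⟨h₄, h₅, fun y hy => h₆ y ?_⟩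
          have : x ≠ (opId, ix) := by rintro rfl; simp [hs] at hy
          simp [this, hy]
    | some tx' =>
      by_cases hid : tx'.id = tx.id
      · obtain rfl := Tx.id_injective hid
        simp only [hop, hout, if_neg hr, hs, if_true] at h ⊢
        obtain ⟨h₁, h₂, h₃⟩ := ih h
        refine ⟨h₁, h₂, fun x hx => ?_⟩
        rcases List.mem_cons.1 hx with rfl | hx
        · exact ⟨by simp [hop], h₂ _ hs, by simp [hs]⟩
        · exact h₃ x hx
      · simp [hop, hout, hr, hs, hid] at h

theorem NodeInv.checkTx_sound (h : NodeInv P G s) (tx : Tx) : Sound P G s (s.checkTx tx).1 := by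
  unfold NodeState.checkTx
  split_ifs
  · exact .refl h
  · split
    · exact .refl h
    · exact checkInputs_sound tx _ _ h
  · exact .refl h

/-- On the way from `s` to `s'` the node has checked `tx`: its parents are accepted, and it is the
recorded spender of its inputs, which have had no other before. -/
def Checked (s s' : NodeState) (tx : Tx) : Prop :=
  ∀ x ∈ tx.inputs, s'.txAccept x.1 ≠ none ∧ s'.children x = some tx ∧
    ∀ y, s.children x = some y → y = tx

/-- The shortcut for accepted transactions bypasses the check of inputs, but what is accepted is
sealed. -/
theorem NodeInv.checkTx_true (h : NodeInv P G s) {tx : Tx} (ht : (s.checkTx tx).2.1 = true) :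
    Sealed P G tx ∨ Checked s (s.checkTx tx).1 tx := by
  by_cases h₁ : s.txAccept tx.id ≠ none
  · exact .inl (h.sealed_of_ne_none h₁)
  unfold NodeState.checkTx at ht ⊢
  rw [if_neg h₁] at ht ⊢
  by_cases h₂ : ¬ tx.SigValid
  · simp [h₂] at ht
  rw [if_neg h₂] at ht ⊢
  cases hc : s.conflicting tx.id with
  | some tx' => simp [hc] at ht
  | none =>
    simp only [hc] at ht ⊢
    obtain ⟨h₃, -, h₄⟩ := checkInputs_true ht
    refine .inr fun x hx => ?_
    rw [h₃]
    exact h₄ x hx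

theorem NodeInv.checkProofTx_sound (h : NodeInv P G s) (ok : Bool) (conf : Option Tx) (tx : Tx)
    (ops : List Sig) {proof : Option TxProof} (hproof : ∀ q ∈ proof, G q.sig) :
    Sound P G s (s.checkProofTx P ok conf tx ops proof).1 := by
  unfold NodeState.checkProofTx
  split_ifs
  · exact .refl h
  · split
    · exact h.accept_sound (hproof _ rfl) _
    · exact .refl h

theorem checkProofTx_of_ok (conf : Option Tx) (tx : Tx) (ops : List Sig) (proof : Option TxProof) :
    (s.checkProofTx P true conf tx ops proof).1 = s := by
  simp [NodeState.checkProofTx]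

/-- When the check of the transaction has failed, only a previous acceptance or a verifying
signature can still lead to a vote. Either one shows that the transaction is sealed. -/
theorem NodeInv.checkProofTx_true (h : NodeInv P G s) {conf : Option Tx} {tx : Tx}
    {ops : List Sig} {proof : Option TxProof} (hproof : ∀ q ∈ proof, G q.sig)
    (ht : (s.checkProofTx P false conf tx ops proof).2 = true) : Sealed P G tx := by
  by_cases h₁ : s.txAccept tx.id ≠ none
  · exact h.sealed_of_ne_none h₁
  unfold NodeState.checkProofTx at ht
  rw [if_neg (by simpa using h₁)] at ht
  split at ht
  · exact ⟨_, _, verify_of_accept_true ht, hproof _ rfl, rfl⟩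
  · simp at ht

theorem NodeInv.conflictTxCheck_sound (h : NodeInv P G s) (tx tx' : Tx) :
    Sound P G s (s.conflictTxCheck tx tx').1 := by
  unfold NodeState.conflictTxCheck
  split_ifs
  · exact .of_eq h rfl rfl rfl rfl
  · exact .refl h

theorem NodeInv.proofCheck_sound (h : NodeInv P G s) (p : Proposal) :
    Sound P G s (s.proofCheck P p).1 := by
  unfold NodeState.proofCheck
  dsimp only
  split_ifs
  · exact .refl h
  · exact .refl h
  · split
    · split_ifs
      · exact h.conflictTxCheck_sound _ _
      · exact .refl h
    · exact .refl h

theorem NodeInv.internalStep_sound (h : NodeInv P G s) (hs : InternalStep P s s') :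
    Sound P G s s' := by
  cases hs with
  | complete j e m p =>
    exact (h.proofCheck_sound p).trans (.of_eq (h.proofCheck_sound p).1 rfl rfl rfl rfl)
  | incomplete j e m p => exact h.proofCheck_sound p
  | select tx => exact h.checkTx_sound tx
  | conflict tx tx' => exact h.conflictTxCheck_sound tx tx'
  | _ => exact .of_eq h rfl rfl rfl rfl

theorem NodeInv.recvProposal_sound (h : NodeInv P G s) {p : Proposal} (hp : ∀ σ ∈ p.sigs, G σ) :
    Sound P G s (s.recvProposal P p) := by
  unfold NodeState.recvProposal
  split_ifs
  · refine ⟨⟨h.accepted, h.sig, ?_⟩, ⟨(Evolves.refl (P := P) (G := G) s).accepted,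
      (Evolves.refl s).children⟩⟩
    rintro q (rfl | hq)
    · exact hp
    · exact h.pending q hq
  · exact .refl h

theorem NodeInv.newTx_sound (h : NodeInv P G s) (tx : Tx) {ops : List Sig} (hops : ∀ σ ∈ ops, G σ)
    (cs : List Content) : Sound P G s (s.newTx P tx ops cs) := by
  have h₁ := h.acceptAll_zip_sound hops cs
  unfold NodeState.newTx
  dsimp only
  split_ifs
  · exact h₁.trans (h₁.1.checkTx_sound tx)
  · exact h₁
  · exact .refl h

theorem NodeInv.recvAPS_sound (h : NodeInv P G s) {A : APS} (hA : ∀ σ ∈ A.sigs, G σ) :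
    Sound P G s (s.recvAPS P A) := by
  cases A with
  | typeI σ c => exact h.accept_sound (hA _ (by simp [APS.sigs])) c
  | typeII σ c σ' c' =>
    have h₁ := h.accept_sound (hA σ (by simp [APS.sigs])) c
    exact h₁.trans (h₁.1.accept_sound (hA _ (by simp [APS.sigs])) c')

/-- For Type II the first signature alone gives acceptance; processing the second one, whether or
not it is accepted, cannot revoke it. -/
theorem NodeInv.accepted_recvAPS (h : NodeInv P G s) {A : APS} (hA : ∀ σ ∈ A.sigs, G σ)
    (hv : A.Valid P) (he : A.content.epoch ≤ s.epoch) : (s.recvAPS P A).Accepted A.tx := by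
  cases A with
  | typeI σ c => exact h.accepted_accept he hv
  | typeII σ c σ' c' =>
    have h₁ := h.accept_sound (hA σ (by simp [APS.sigs])) c
    exact (h₁.1.accept_sound (hA σ' (by simp [APS.sigs])) c').2.accepted_of
      (h.accepted_accept he hv.1)

theorem NodeInv.checkAndVote_sound (h : NodeInv P G s) {p : Proposal} (hp : ∀ σ ∈ p.sigs, G σ) :
    Sound P G s (s.checkAndVote P p).1 ∧ ((s.checkAndVote P p).2 = true →
      Sealed P G p.tx ∨ Checked s (s.checkAndVote P p).1 p.tx) := by
  have hops : ∀ σ ∈ p.ops, G σ := fun σ hσ => hp σ (by simp [Proposal.sigs, hσ])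
  have hproof : ∀ q ∈ p.txProof, G q.sig := by
    intro q hq
    rw [Option.mem_def] at hq
    exact hp _ (by simp [Proposal.sigs, hq])
  unfold NodeState.checkAndVote
  dsimp only
  have h₁ := h.acceptAll_zip_sound hops p.opContents
  set r := s.acceptAll P (p.ops.zip p.opContents)
  have h₂ := h₁.1.checkTx_sound p.tx
  have h₃ := h₁.1.checkTx_true (tx := p.tx)
  set q := r.1.checkTx p.tx
  have h₄ := h₂.1.checkProofTx_sound q.2.1 q.2.2 p.tx p.ops hproof
  split_ifs with hr hv
  · refine ⟨(h₁.trans (h₂.trans h₄)).trans (.of_eq h₄.1 rfl rfl rfl rfl), fun _ => ?_⟩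
    by_cases hq : q.2.1 = true
    · rcases h₃ hq with h₃ | h₃
      · exact .inl h₃
      -- The check ran after the official parents were accepted, but `Checked` speaks of the records
      -- before. A record changed in between would be sealed, while the check forces it to be
      -- `p.tx`, which is not sealed; so it was there from the start.
      · refine or_iff_not_imp_left.2 fun hn x hx => ?_
        rw [hq, checkProofTx_of_ok]
        obtain ⟨h₅, h₆, h₇⟩ := h₃ x hx
        refine ⟨h₅, h₆, fun y hy => ?_⟩
        obtain ⟨y', hy', hyy⟩ := h₁.2.children x y hy
        obtain rfl := h₇ y' hy'
        exact (hyy.resolve_right hn).symm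
    · have hw := hv.1.resolve_left hq
      rw [Bool.not_eq_true] at hq
      rw [hq] at hw
      exact .inl (h₂.1.checkProofTx_true hproof hw)
  · exact ⟨h₁.trans (h₂.trans h₄), by simp⟩
  · exact ⟨h₁, by simp⟩

theorem NodeInv.processProposal_sound (h : NodeInv P G s) {p : Proposal} (hp : p ∈ s.pending) :
    Sound P G s (s.processProposal P p).1 ∧ ((s.processProposal P p).2 = true →
      Sealed P G p.tx ∨ Checked s (s.processProposal P p).1 p.tx) := by
  have hsig := h.pending p hp
  unfold NodeState.processProposal
  split
  · exact ⟨.refl h, by simp⟩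
  · rename_i c _
    dsimp only
    have h₁ := h.accept_sound (hsig p.vp (by simp [Proposal.sigs])) c
    split_ifs
    -- The same transfer of records, now back across the acceptance of the virtual parent.
    · obtain ⟨h₂, h₃⟩ := h₁.1.checkAndVote_sound hsig
      refine ⟨h₁.trans h₂, fun ht => or_iff_not_imp_left.2 fun hn x hx => ?_⟩
      obtain ⟨h₅, h₆, h₇⟩ := (h₃ ht).resolve_left hn x hx
      refine ⟨h₅, h₆, fun y hy => ?_⟩
      obtain ⟨y', hy', hyy⟩ := h₁.2.children x y hy
      obtain rfl := h₇ y' hy'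
      exact (hyy.resolve_right hn).symm
    · exact ⟨h₁, by simp⟩

/-- The initial transaction counts as sealed, by the initial signature; it is the one sealed
transaction that needs no quorum. -/
theorem NodeInv.init (hG : G Sig.initial) : NodeInv P G (NodeState.init P) where
  accepted id tx σs h := by
    by_cases hid : id = P.genesis.id
    · subst hid
      simp only [NodeState.init, Function.update_self, Option.some.injEq, Prod.mk.injEq] at h
      obtain ⟨rfl, -⟩ := h
      exact ⟨rfl, Sig.initial, P.genesisContent, .inr ⟨rfl, rfl, rfl⟩, hG, rfl⟩
    · simp [NodeState.init, Function.update_of_ne hid] at h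
  sig σ c h := by
    by_cases hσ : σ = Sig.initial
    · subst hσ
      simp only [NodeState.init, Function.update_self, Option.some.injEq] at h
      subst h
      exact ⟨.inr ⟨rfl, rfl, rfl⟩, [Sig.initial], by
        simp [NodeState.init, Params.genesisContent]⟩
    · simp [NodeState.init, Function.update_of_ne hσ] at h
  pending p hp := by simp [NodeState.init] at hp

/-! ### Steps of the network -/

variable {R : Type*} {g g' : Global P R}

theorem Global.Generated.mono (hc : g.corrupted ⊆ g'.corrupted) (hp : g.partials ⊆ g'.partials)
    {σ : Sig} (h : g.Generated σ) : g'.Generated σ := by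
  cases h with
  | initial => exact .initial
  | other k => exact .other k
  | combine e c T hT h =>
    exact .combine e c T hT fun i hi => (h i hi).imp (fun h => hc h) fun h => hp h

theorem Global.Generated.exists_quorum {e : ℕ} {c : Content} (h : g.Generated (c.sig e)) :
    ∃ T : Finset (Fin P.n), P.k ≤ T.card ∧ ∀ i ∈ T, g.HasPartial i e c := by
  generalize hσ : c.sig e = σ at h
  cases h with
  | initial => simp [Content.sig] at hσ
  | other k => simp [Content.sig] at hσ
  | combine e' c' T hT h =>
    obtain ⟨rfl, rfl⟩ := Content.sig_inj hσ
    exact ⟨T, hT, h⟩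

/-- The consensus nodes that are corrupted. -/
def Global.corruptedNodes (g : Global P R) : Set (Fin P.n) := {i | Sum.inl i ∈ g.corrupted}

/-- What a step does to the nodes, the corruptions and the partial signatures. -/
structure StepSound (g g' : Global P R) : Prop where
  node : ∀ a, Sound P g.Generated (g.node a) (g'.node a)
  corrupted : g.corrupted ⊆ g'.corrupted
  bound : g.corruptedNodes.ncard ≤ P.t → g'.corruptedNodes.ncard ≤ P.t
  partials : g.partials ⊆ g'.partials
  vote : ∀ i e c, (i, e, c) ∈ g'.partials → (i, e, c) ∈ g.partials ∨ Sealed P g.Generated c.tx ∨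
    Checked (g.node (.inl i)) (g'.node (.inl i)) c.tx

theorem sound_setNode (h : ∀ a, NodeInv P g.Generated (g.node a)) {a : Fin P.n ⊕ R} {s : NodeState}
    (hs : Sound P g.Generated (g.node a) s) (b : Fin P.n ⊕ R) :
    Sound P g.Generated (g.node b) ((g.setNode a s).node b) := by
  by_cases hb : b = a
  · subst hb
    simpa [Global.setNode] using hs
  · simpa [Global.setNode, hb] using Sound.refl (h b)

theorem stepSound_setNode (h : ∀ a, NodeInv P g.Generated (g.node a)) {a : Fin P.n ⊕ R}
    {s : NodeState} (hs : Sound P g.Generated (g.node a) s) : StepSound g (g.setNode a s) :=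
  ⟨sound_setNode h hs, subset_rfl, id, subset_rfl, fun _ _ _ h => .inl h⟩

/-- Only a `vote` step adds a partial signature, and its alternative `Sealed` refers to the
signatures available before the step. -/
theorem Step.sound (h : ∀ a, NodeInv P g.Generated (g.node a)) (hs : Step g g') :
    StepSound g g' := by
  cases hs with
  | corrupt a ha =>
    exact ⟨fun b => .refl (h b), Set.subset_insert _ _, fun _ => ha, subset_rfl,
      fun _ _ _ h => .inl h⟩
  | recvAPS a ha A hA => exact stepSound_setNode h ((h a).recvAPS_sound hA)
  | recvTx a ha tx ops cs hops => exact stepSound_setNode h ((h a).newTx_sound tx hops cs)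
  | nextEpoch a ha => exact stepSound_setNode h (.of_eq (h a) rfl rfl rfl rfl)
  | recvProposal i hi p hp => exact stepSound_setNode h ((h _).recvProposal_sound hp)
  | internal i hi s hs => exact stepSound_setNode h ((h _).internalStep_sound hs)
  | reject i hi p hp hv => exact stepSound_setNode h ((h _).processProposal_sound hp).1
  | vote i hi p hp hv =>
    obtain ⟨h₁, h₂⟩ := (h (.inl i)).processProposal_sound hp
    refine ⟨sound_setNode h h₁, subset_rfl, id, Set.subset_insert _ _, ?_⟩
    rintro j e c (hj | hj)
    · simp only [Prod.mk.injEq] at hj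
      obtain ⟨rfl, rfl, rfl⟩ := hj
      simpa [Global.setNode, Proposal.content] using Or.inr (h₂ hv)
    · exact .inl hj

theorem StepSound.generated (h : StepSound g g') {σ : Sig} (hσ : g.Generated σ) :
    g'.Generated σ :=
  hσ.mono h.corrupted h.partials

/-! ### The global invariant -/

/-- The invariant of an execution. `V` is the set of first-hand votes: `(i, tx) ∈ V` if node `i`
has voted for `tx` when `tx` was not sealed yet. -/
structure Inv (g : Global P R) (V : Set (Fin P.n × Tx)) : Prop where
  node : ∀ a, NodeInv P g.Generated (g.node a)
  bound : g.corruptedNodes.ncard ≤ P.t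
  quorum : ∀ tx, Sealed P g.Generated tx → tx = P.genesis ∨ ∃ T : Finset (Fin P.n),
    P.k ≤ T.card ∧ ∀ i ∈ T, i ∈ g.corruptedNodes ∨ (i, tx) ∈ V
  vote : ∀ i e c, (i, e, c) ∈ g.partials → (i, c.tx) ∈ V ∨ Sealed P g.Generated c.tx
  consistent : ∀ i tx tx', (i, tx) ∈ V → (i, tx') ∈ V → ¬ DoubleSpend tx tx'
  spends : ∀ i tx, (i, tx) ∈ V → ∀ x ∈ tx.inputs,
    ∃ y, (g.node (.inl i)).children x = some y ∧ (y = tx ∨ Sealed P g.Generated y)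
  parents : ∀ i tx, (i, tx) ∈ V → ∀ p, IsParent p tx → Sealed P g.Generated p

theorem Inv.init : Inv (Global.init P R) ∅ where
  node a := NodeInv.init .initial
  bound := by simp [Global.corruptedNodes, Global.init]
  quorum := by
    rintro tx ⟨σ, c, rfl | ⟨-, -, rfl⟩, hσ, rfl⟩
    · obtain ⟨T, hT, h⟩ := hσ.exists_quorum
      -- Initially nobody is corrupted or has voted, so no node can belong to `T`.
      refine .inr ⟨T, hT, fun i hi => ?_⟩
      simpa [Global.HasPartial, Global.init] using h i hi
    · exact .inl rfl
  vote i e c h := by simp [Global.init] at h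
  consistent i tx tx' h := by simp at h
  spends i tx h := by simp at h
  parents i tx h := by simp at h

theorem DoubleSpend.symm {a b : Tx} (h : DoubleSpend a b) : DoubleSpend b a :=
  let ⟨h₁, x, h₂, h₃⟩ := h
  ⟨h₁.symm, x, h₃, h₂⟩

/-- At a common input the record is `tx` or something sealed, since `tx` got a first-hand vote. The
check of `tx'` requires the record to be `tx'`. So `tx'` would equal `tx` or be sealed. -/
theorem Inv.not_doubleSpend_of_checked {V : Set (Fin P.n × Tx)} (h : Inv g V) {i : Fin P.n}
    {s : NodeState} {tx tx' : Tx} (hV : (i, tx) ∈ V) (hn : ¬ Sealed P g.Generated tx')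
    (hc : Checked (g.node (.inl i)) s tx') : ¬ DoubleSpend tx tx' := by
  rintro ⟨hne, x, hx, hx'⟩
  obtain ⟨y, hy, hyt⟩ := h.spends i tx hV x hx
  obtain rfl := (hc x hx').2.2 y hy
  exact hyt.elim (fun e => hne e.symm) hn

theorem Inv.step {V : Set (Fin P.n × Tx)} (h : Inv g V) (hs : Step g g') :
    ∃ V', Inv g' V' := by
  have hss := hs.sound h.node
  have hmono : ∀ tx, Sealed P g.Generated tx → Sealed P g'.Generated tx :=
    fun tx => Sealed.mono fun _ => hss.generated
  -- The new first-hand votes lie in `W`. It may also contain pairs without a vote, for instance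
  -- unsealed transactions without inputs; these do no harm, as consistency, records and parents
  -- follow from `Checked` alone.
  let W : Set (Fin P.n × Tx) := {q | ¬ Sealed P g.Generated q.2 ∧
    Checked (g.node (.inl q.1)) (g'.node (.inl q.1)) q.2}
  have hnode : ∀ a, NodeInv P g'.Generated (g'.node a) :=
    fun a => (hss.node a).1.mono fun _ => hss.generated
  -- Sealed before the step, not after it: this sharper form shows that a signature sealing its
  -- transaction just now rests on first-hand votes only.
  have hvote : ∀ i e c, (i, e, c) ∈ g'.partials →
      (i, c.tx) ∈ V ∪ W ∨ Sealed P g.Generated c.tx := by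
    intro i e c hi
    refine or_iff_not_imp_right.2 fun hn => ?_
    rcases hss.vote i e c hi with hi | hi | hi
    · exact .inl ((h.vote i e c hi).resolve_right hn)
    · exact absurd hi hn
    · exact .inr ⟨hn, hi⟩
  refine ⟨V ∪ W, hnode, hss.bound h.bound, ?_, ?_, ?_, ?_, ?_⟩
  · intro tx htx
    by_cases hold : Sealed P g.Generated tx
    · refine (h.quorum tx hold).imp_right ?_
      rintro ⟨T, hT, hi⟩
      exact ⟨T, hT, fun i hiT => (hi i hiT).imp (fun hc => hss.corrupted hc) .inl⟩
    · obtain ⟨σ, c, rfl | ⟨-, -, rfl⟩, hσ, rfl⟩ := htx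
      · obtain ⟨T, hT, hi⟩ := hσ.exists_quorum
        exact .inr ⟨T, hT, fun i hiT => (hi i hiT).imp id
          fun hp => (hvote i _ c hp).resolve_right hold⟩
      · exact .inl rfl
  · exact fun i e c hi => (hvote i e c hi).imp_right (hmono _)
  · rintro i tx tx' (hV | hW) (hV' | hW')
    · exact h.consistent i tx tx' hV hV'
    · exact h.not_doubleSpend_of_checked hV hW'.1 hW'.2
    · exact fun hd => h.not_doubleSpend_of_checked hV' hW.1 hW.2 hd.symm
    · rintro ⟨hne, x, hx, hx'⟩
      -- Both would be the recorded spender of `x` after the step.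
      exact hne (Option.some.inj ((hW.2 x hx).2.1.symm.trans (hW'.2 x hx').2.1))
  · rintro i tx (hV | hW) x hx
    · obtain ⟨y, hy, hyt⟩ := h.spends i tx hV x hx
      obtain ⟨y', hy', hyy⟩ := (hss.node (.inl i)).2.children x y hy
      refine ⟨y', hy', ?_⟩
      rcases hyy with rfl | hyy
      · exact hyt.imp_right (hmono _)
      · exact .inr (hmono _ hyy)
    · exact ⟨tx, (hW.2 x hx).2.1, .inl rfl⟩
  · rintro i tx (hV | hW) p hp
    · exact hmono _ (h.parents i tx hV p hp)
    · obtain ⟨ix, hix⟩ := hp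
      exact (hnode (.inl i)).sealed_of_ne_none (hW.2 _ hix).1

theorem Reaches.exists_inv (hr : Reaches g g') {V : Set (Fin P.n × Tx)} (h : Inv g V) :
    ∃ V', Inv g' V' := by
  induction hr with
  | refl => exact ⟨V, h⟩
  | tail _ hs ih =>
    obtain ⟨V', h'⟩ := ih
    exact h'.step hs

theorem Reachable.exists_inv (hr : Reachable g) : ∃ V, Inv g V :=
  Reaches.exists_inv hr Inv.init

/-- Along an execution, accepted transactions remain accepted and sealed ones sealed. -/
theorem Inv.persist {V : Set (Fin P.n × Tx)} (h : Inv g V) (hr : Reaches g g') :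
    (∀ a tx, (g.node a).Accepted tx → (g'.node a).Accepted tx) ∧
      ∀ tx, Sealed P g.Generated tx → Sealed P g'.Generated tx := by
  induction hr with
  | refl => exact ⟨fun _ _ => id, fun _ => id⟩
  | tail hr hs ih =>
    obtain ⟨V', h'⟩ := Reaches.exists_inv hr h
    have hss := hs.sound h'.node
    exact ⟨fun a tx ha => (hss.node a).2.accepted_of (ih.1 a tx ha),
      fun tx ht => (ih.2 tx ht).mono fun _ => hss.generated⟩

/-! ### Quorums -/

theorem Params.two_mul_k_ge (P : Params) : P.n + P.t + 1 ≤ 2 * P.k := by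
  have h : ((P.n : ℚ) + P.t + 1) / 2 ≤ P.k := Nat.le_ceil _
  have : ((P.n + P.t + 1 : ℕ) : ℚ) ≤ ((2 * P.k : ℕ) : ℚ) := by push_cast; linarith
  exact_mod_cast this

/-- Two quorums have an honest node in common. -/
theorem exists_honest_mem_inter {C : Set (Fin P.n)} (hC : C.ncard ≤ P.t) {T T' : Finset (Fin P.n)}
    (hT : P.k ≤ T.card) (hT' : P.k ≤ T'.card) : ∃ i ∈ T, i ∈ T' ∧ i ∉ C := by
  by_contra! hall
  have h₁ : (T ∩ T').card ≤ P.t := by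
    refine le_trans ?_ hC
    rw [← Set.ncard_coe_finset]
    refine Set.ncard_le_ncard (fun i hi => ?_) (Set.toFinite C)
    rw [Finset.mem_coe, Finset.mem_inter] at hi
    exact hall i hi.1 hi.2
  have h₂ := Finset.card_union_add_card_inter T T'
  have h₃ : (T ∪ T').card ≤ P.n := by simpa using Finset.card_le_univ (T ∪ T')
  have h₄ := P.two_mul_k_ge
  -- The intersection has at least `2 * P.k - P.n ≥ P.t + 1` elements, contradicting `h₁`.
  omega

/-- A single quorum, intersected with itself, contains an honest node; this node has voted
first-hand, hence with the parents accepted. The initial transaction has no parents. -/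
theorem Inv.sealed_parent {V : Set (Fin P.n × Tx)} (h : Inv g V) {p tx : Tx}
    (htx : Sealed P g.Generated tx) (hp : IsParent p tx) : Sealed P g.Generated p := by
  rcases h.quorum tx htx with rfl | ⟨T, hT, hi⟩
  · obtain ⟨ix, hix⟩ := hp
    simp [Params.genesis] at hix
  · obtain ⟨i, hiT, -, hiC⟩ := exists_honest_mem_inter h.bound hT hT
    exact h.parents i tx ((hi i hiT).resolve_left hiC) p hp

theorem Inv.sealed_ancestor {V : Set (Fin P.n × Tx)} (h : Inv g V) {a tx : Tx}
    (htx : Sealed P g.Generated tx) (ha : Relation.ReflTransGen IsParent a tx) :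
    Sealed P g.Generated a := by
  induction ha using Relation.ReflTransGen.head_induction_on with
  | refl => exact htx
  | head hp _ ih => exact h.sealed_parent ih hp

theorem Inv.not_conflict {V : Set (Fin P.n × Tx)} (h : Inv g V) {tx tx' : Tx}
    (htx : Sealed P g.Generated tx) (htx' : Sealed P g.Generated tx') : ¬ Conflict tx tx' := by
  rintro ⟨a, a', ha, ha', hd⟩
  obtain ⟨-, x, hx, hx'⟩ := id hd
  rcases h.quorum a (h.sealed_ancestor htx ha) with rfl | ⟨T, hT, hi⟩
  · simp [Params.genesis] at hx
  rcases h.quorum a' (h.sealed_ancestor htx' ha') with rfl | ⟨T', hT', hi'⟩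
  · simp [Params.genesis] at hx'
  obtain ⟨i, hiT, hiT', hiC⟩ := exists_honest_mem_inter h.bound hT hT'
  exact h.consistent i a a' ((hi i hiT).resolve_left hiC) ((hi' i hiT').resolve_left hiC) hd

theorem APS.Valid.sealed {A : APS} (hv : A.Valid P) (hA : ∀ σ ∈ A.sigs, G σ) :
    Sealed P G A.tx := by
  cases A with
  | typeI σ c => exact ⟨σ, c, hv, hA _ (by simp [APS.sigs]), rfl⟩
  | typeII σ c σ' c' => exact ⟨σ, c, hv.1, hA _ (by simp [APS.sigs]), rfl⟩

end Ocior

theorem theorem1 (P : Ocior.Params) (hres : 3 * P.t + 1 ≤ P.n) (R : Type*) :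
    -- transactions accepted by honest nodes, possibly at different times, do not conflict
    (∀ g₁ g₂ : Ocior.Global P R, Ocior.Reachable g₁ → Ocior.Reaches g₁ g₂ →
      ∀ (a b : Fin P.n ⊕ R) (tx tx' : Ocior.Tx), a ∉ g₁.corrupted → b ∉ g₂.corrupted →
        (g₁.node a).Accepted tx → (g₂.node b).Accepted tx' → ¬ Ocior.Conflict tx tx') ∧
    -- transactions for which valid APSs are generated do not conflict
    (∀ g : Ocior.Global P R, Ocior.Reachable g → ∀ A A' : Ocior.APS,
      (∀ σ ∈ A.sigs, g.Generated σ) → A.Valid P →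
      (∀ σ ∈ A'.sigs, g.Generated σ) → A'.Valid P → ¬ Ocior.Conflict A.tx A'.tx) ∧
    -- an honest node that receives a valid APS accepts the transaction, irrevocably
    (∀ g : Ocior.Global P R, Ocior.Reachable g → ∀ (a : Fin P.n ⊕ R) (A : Ocior.APS),
      a ∉ g.corrupted → (∀ σ ∈ A.sigs, g.Generated σ) → A.Valid P →
      A.content.epoch ≤ (g.node a).epoch →
      ∀ g' : Ocior.Global P R, Ocior.Reaches (g.receive a A) g' →
        (g'.node a).Accepted A.tx) := by
  refine ⟨?_, ?_, ?_⟩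
  · intro g₁ g₂ hr hr' a b tx tx' _ _ htx htx'
    obtain ⟨V, h⟩ := hr.exists_inv
    obtain ⟨V', h'⟩ := hr'.exists_inv h
    -- Being sealed is global and permanent, so the comparison can be made in `g₂` even if `a` is
    -- corrupted by then.
    exact h'.not_conflict ((h.persist hr').2 tx ((h.node a).sealed htx)) ((h'.node b).sealed htx')
  · intro g hr A A' hA hv hA' hv'
    obtain ⟨V, h⟩ := hr.exists_inv
    exact h.not_conflict (hv.sealed hA) (hv'.sealed hA')
  · intro g hr a A ha hA hv he g' hr'
    obtain ⟨V, h⟩ := hr.exists_inv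
    obtain ⟨V', h'⟩ := h.step (.recvAPS g a ha A hA)
    refine (h'.persist hr').1 a A.tx ?_
    simpa [Ocior.Global.receive, Ocior.Global.setNode] using (h.node a).accepted_recvAPS hA hv he
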